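/- Let $d\ge 1$ and let $\alpha=(\alpha_1,\dots,\alpha_d)\in\mathbb R^d$ have irrational coordinates. Let $\mathbb T^d=(\mathbb R/\mathbb Z)^d$ and, for $t\in\mathbb R$, let $\|t\|_{\mathbb T}=\operatorname{dist}(t,\mathbb Z)$. For a continuous function $f:\mathbb T^d\to\mathbb R$ and $x\in\mathbb T^d$, let $H_x$ be the operator on $\ell^2(\mathbb Z^d)$ (complex-valued sequences) given by $$(H_xu)_n=\sum_{|m-n|=1}u_m+f(x_1+n_1\alpha_1,\dots,x_d+n_d\alpha_d)\,u_n,\qquad |m|=\sum_{j=1}^d|m_j|.$$ Suppose that there is a sequence $\tau^{(n)}=(\tau^{(n)}_1,\dots,\tau^{(n)}_d)$ of vectors of positive integers such that $$\lim_{n\to\infty}\frac{\tau^{(n)}_1\cdots\tau^{(n)}_d}{\tau^{(n)}_i}\,\bigl\|\tau^{(n)}_i\alpha_i\bigr\|_{\mathbb T}=0\qquad\text{for every } i=1,\dots,d.$$ Then there is a dense $G_\delta$ set $\mathcal F$ in the space $C(\mathbb T^d,\mathbb R)$ with the supremum norm such that, for every $f\in\mathcal F$ and for Lebesgue-a.e.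 $x\in\mathbb T^d$, the operator $H_x$ has no eigenvalues. -/

import Mathlib

open scoped ENNReal

noncomputable section

namespace QPSchrodinger

/-- The torus `𝕋^d = (ℝ/ℤ)^d`; its `volume` is the normalized Lebesgue (Haar) measure. -/
abbrev Torus (d : ℕ) : Type := Fin d → UnitAddCircle

/-- The complex Hilbert space `ℓ²(ℤ^d)`. -/
abbrev L2Z (d : ℕ) : Type := lp (fun _ : Fin d → ℤ => ℂ) 2

/-- The phase `x + n ⋆ α`, with coordinates `x_i + n_i α_i` in `ℝ/ℤ`. -/
def shiftPhase {d : ℕ} (α : Fin d → ℝ) (x : Torus d) (n : Fin d → ℤ) : Torus d :=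
  fun i => x i + (((n i : ℝ) * α i : ℝ) : UnitAddCircle)

/-- The finite set of all `m ∈ ℤ^d` with `|m - n| = ∑ j, |m_j - n_j| = 1`. -/
def neighbors {d : ℕ} (n : Fin d → ℤ) : Finset (Fin d → ℤ) :=
  (Finset.Icc (n - 1) (n + 1)).filter fun m => ∑ j, |m j - n j| = 1

theorem mem_neighbors {d : ℕ} (n m : Fin d → ℤ) :
    m ∈ neighbors n ↔ ∑ j, |m j - n j| = 1 := by
  unfold neighbors
  rw [Finset.mem_filter, and_iff_right_iff_imp]
  intro h
  have hj : ∀ j, |m j - n j| ≤ 1 := fun j => by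
    rw [← h]
    exact Finset.single_le_sum (f := fun j => |m j - n j|) (fun i _ => abs_nonneg _)
      (Finset.mem_univ j)
  rw [Finset.mem_Icc]
  refine ⟨fun j => ?_, fun j => ?_⟩
  · have := (abs_le.mp (hj j)).1
    simp only [Pi.sub_apply, Pi.one_apply]
    linarith
  · have := (abs_le.mp (hj j)).2
    simp only [Pi.add_apply, Pi.one_apply]
    linarith

/-- The formal expression `(H_x u)_n = ∑_{|m-n|=1} u_m + f(x + n ⋆ α) u_n`. -/
def formalH {d : ℕ} (α : Fin d → ℝ) (f : C(Torus d, ℝ)) (x : Torus d)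
    (u : (Fin d → ℤ) → ℂ) (n : Fin d → ℤ) : ℂ :=
  ∑ m ∈ neighbors n, u m + (f (shiftPhase α x n) : ℂ) * u n

theorem sum_neighbors_eq {d : ℕ} (u : (Fin d → ℤ) → ℂ) (n : Fin d → ℤ) :
    ∑ m ∈ neighbors n, u m = ∑ e ∈ neighbors (0 : Fin d → ℤ), u (n + e) := by
  refine Finset.sum_bij' (fun m _ => m - n) (fun e _ => n + e) ?_ ?_ ?_ ?_ ?_
  · intro m hm
    rw [mem_neighbors] at hm ⊢
    simpa using hm
  · intro e he
    rw [mem_neighbors] at he ⊢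
    simpa using he
  · intro m _
    abel
  · intro e _
    abel
  · intro m _
    congr 1
    abel

/-- `H_x` maps `ℓ²(ℤ^d)` into itself. -/
theorem memlp_formalH {d : ℕ} (α : Fin d → ℝ) (f : C(Torus d, ℝ)) (x : Torus d) (u : L2Z d) :
    Memℓp (formalH α f x u) 2 := by
  have h2 : (0 : ℝ) < (2 : ℝ≥0∞).toReal := by norm_num
  have hsum : Memℓp (fun n : Fin d → ℤ => ∑ m ∈ neighbors n, u m) 2 := by
    have : (fun n : Fin d → ℤ => ∑ m ∈ neighbors n, u m)
        = fun n => ∑ e ∈ neighbors (0 : Fin d → ℤ), u (n + e) :=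
      funext fun n => sum_neighbors_eq u n
    rw [this]
    refine Memℓp.finsetSum (E := fun _ : Fin d → ℤ => ℂ) (neighbors (0 : Fin d → ℤ))
      (f := fun e n => u (n + e)) fun e _ => ?_
    refine (memℓp_gen_iff h2).2 ?_
    exact (Equiv.addRight e).summable_iff.2 ((memℓp_gen_iff h2).1 (lp.memℓp u))
  have hpot : Memℓp (fun n : Fin d → ℤ => (f (shiftPhase α x n) : ℂ) * u n) 2 := by
    have hu := (memℓp_gen_iff h2).1 ((lp.memℓp u).const_smul ((‖f‖ : ℝ) : ℂ))
    refine (memℓp_gen_iff h2).2 (hu.of_nonneg_of_le (fun n => by positivity) fun n => ?_)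
    refine Real.rpow_le_rpow (norm_nonneg _) ?_ h2.le
    rw [Pi.smul_apply, norm_mul, norm_smul, Complex.norm_real, Complex.norm_real, norm_norm]
    exact mul_le_mul_of_nonneg_right (f.norm_coe_le_norm _) (norm_nonneg _)
  exact hsum.add hpot

/-- The operator `H_x` on `ℓ²(ℤ^d)`, `(H_x u)_n = ∑_{|m-n|=1} u_m + f(x + n ⋆ α) u_n`. -/
def H {d : ℕ} (α : Fin d → ℝ) (f : C(Torus d, ℝ)) (x : Torus d) : Module.End ℂ (L2Z d) where
  toFun u := ⟨formalH α f x u, memlp_formalH α f x u⟩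
  map_add' u v := by
    ext n
    change formalH α f x (u + v : L2Z d) n = formalH α f x u n + formalH α f x v n
    simp only [formalH, lp.coeFn_add, Pi.add_apply, Finset.sum_add_distrib]
    ring
  map_smul' c u := by
    ext n
    change formalH α f x (c • u : L2Z d) n = c * formalH α f x u n
    simp only [formalH, lp.coeFn_smul, Pi.smul_apply, smul_eq_mul, ← Finset.mul_sum]
    ring

theorem H_apply {d : ℕ} (α : Fin d → ℝ) (f : C(Torus d, ℝ)) (x : Torus d) (u : L2Z d)
    (n : Fin d → ℤ) :
    H α f x u n = ∑ m ∈ neighbors n, u m + (f (shiftPhase α x n) : ℂ) * u n := rfl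

end QPSchrodinger

end

/-!
Absence of eigenvalues rests on a delocalization estimate for periodic potentials which needs no
bound on the energy and no spectral theory. Let `V` have period `τ_i` in the direction `e_i`, let
`K` be a common multiple of the `τ_i`, and let `u` solve the eigenvalue equation on `[0, 5K)^d`.
The translates of `u` by periods solve the *same* equation on `[0, 4K)^d`. The solutions on that
cube form a space of dimension at most of the order of `K^(d-1)`, since a solution is determined by
its values near the boundary. The diagonal of the orthogonal projection onto this space bounds the
point values of its elements and sums up to the dimension; summing over the `K^d / ∏ τ_j` translates
of `u` bounds `|u_p|² K^d / ∏ τ_j` by a multiple of `K^(d-1) ‖u‖²` for `p` in the middle of the cube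
(`norm_sq_mul_prod_le`). So `K = N ∏ τ_j` gives `|u_p|² ≤ C_d ‖u‖² / N`, and by compactness
(`exists_stability_radius`) this survives small perturbations of the potential, uniformly over
bounded energies.

The hypothesis on `α` says precisely that, for fixed `N`, the phase moves by `o(1)` only along the
`K / τ_i = N ∏ τ_j / τ_i` periods met in the direction `e_i`. Hence a continuous `f`
can be changed slightly so as to become exactly periodic in the height along towers of height
`[0, 5K)^d` for the shift (`exists_near_periodic`). Towers filling a fixed proportion of the torus
exist for arbitrary heights by a greedy choice of the base (`exists_towers`). This makes the set
`delocalized α k` contain a dense open set for every `k`, and Baire's theorem gives the dense `G_δ`.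
For `f` in it, a set of phases of positive measure lies in infinitely many of the good sets, so that
all its normalized eigenfunctions vanish identically; ergodicity of the shift extends this to almost
every phase.
-/

namespace QPSchrodinger

/-! ### Pointwise bounds from the dimension of a space -/

/-- The diagonal `κ` of the orthogonal projection onto `S` bounds point values of the elements of
`S`, and its total mass is the trace of the projection, that is `dim S`. -/
theorem exists_diagonal_bound {ι : Type*} [Fintype ι] (S : Submodule ℂ (EuclideanSpace ℂ ι)) :
    ∃ κ : ι → ℝ, (∀ i, 0 ≤ κ i) ∧ ∑ i, κ i = Module.finrank ℂ S ∧
      ∀ v ∈ S, ∀ i, ‖v i‖ ^ 2 ≤ κ i * ‖v‖ ^ 2 := by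
  let b := stdOrthonormalBasis ℂ S
  refine ⟨fun i => ∑ k, ‖(b k : EuclideanSpace ℂ ι) i‖ ^ 2,
    fun i => Finset.sum_nonneg fun k _ => by positivity, ?_, ?_⟩
  · rw [Finset.sum_comm]
    have h : ∀ k, ∑ i, ‖(b k : EuclideanSpace ℂ ι) i‖ ^ 2 = 1 := fun k => by
      rw [← EuclideanSpace.norm_sq_eq, ← Submodule.coe_norm, b.norm_eq_one, one_pow]
    simp [h]
  · intro v hv i
    have hexp : v i = ∑ k, inner ℂ (b k) (⟨v, hv⟩ : S) * (b k : EuclideanSpace ℂ ι) i := by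
      have h := congrArg (fun w : S => (w : EuclideanSpace ℂ ι) i) (b.sum_repr' ⟨v, hv⟩)
      simp only [Submodule.coe_sum, Submodule.coe_smul, WithLp.ofLp_sum, Finset.sum_apply,
        WithLp.ofLp_smul, Pi.smul_apply, smul_eq_mul] at h
      exact h.symm
    have hpars : ∑ k, ‖inner ℂ (b k) (⟨v, hv⟩ : S)‖ ^ 2 = ‖v‖ ^ 2 := by
      simpa using b.sum_sq_norm_inner_right (⟨v, hv⟩ : S)
    calc ‖v i‖ ^ 2
        ≤ (∑ k, ‖inner ℂ (b k) (⟨v, hv⟩ : S)‖ * ‖(b k : EuclideanSpace ℂ ι) i‖) ^ 2 := by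
          rw [hexp]
          gcongr
          exact (norm_sum_le _ _).trans (Finset.sum_le_sum fun k _ => (norm_mul _ _).le)
      _ ≤ (∑ k, ‖inner ℂ (b k) (⟨v, hv⟩ : S)‖ ^ 2) *
            ∑ k, ‖(b k : EuclideanSpace ℂ ι) i‖ ^ 2 := Finset.sum_mul_sq_le_sq_mul_sq _ _ _
      _ = _ := by rw [hpars, mul_comm]

/-! ### Solutions of the eigenvalue equation in a box -/

/-- The cube `[a, b)^d` of `ℤ^d`. -/
noncomputable def box (d : ℕ) (a b : ℤ) : Finset (Fin d → ℤ) :=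
  Fintype.piFinset fun _ => Finset.Ico a b

theorem mem_box {d : ℕ} {a b : ℤ} {m : Fin d → ℤ} : m ∈ box d a b ↔ ∀ i, a ≤ m i ∧ m i < b := by
  simp [box, Fintype.mem_piFinset]

theorem card_box (d : ℕ) (a b : ℤ) : (box d a b).card = (b - a).toNat ^ d := by
  simp [box, Fintype.card_piFinset]

theorem abs_sub_le_one_of_mem_neighbors {d : ℕ} {n m : Fin d → ℤ} (h : m ∈ neighbors n)
    (j : Fin d) : |m j - n j| ≤ 1 := by
  rw [← (mem_neighbors n m).1 h]
  exact Finset.single_le_sum (f := fun j => |m j - n j|) (fun i _ => abs_nonneg _)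
    (Finset.mem_univ j)

theorem mem_box_of_mem_neighbors {d : ℕ} {a b : ℤ} {n m : Fin d → ℤ}
    (hn : n ∈ box d (a + 1) (b - 1)) (h : m ∈ neighbors n) : m ∈ box d a b := by
  rw [mem_box] at hn ⊢
  intro i
  have h1 := abs_le.1 (abs_sub_le_one_of_mem_neighbors h i)
  have h2 := hn i
  omega

/-- Among the neighbours of `n`, only `n + e_i` lies further than `n` in the direction `e_i`. -/
theorem le_of_mem_neighbors_of_ne {d : ℕ} {n m : Fin d → ℤ} (i : Fin d) (h : m ∈ neighbors n)
    (hne : m ≠ n + Pi.single i 1) : m i ≤ n i := by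
  by_contra hlt
  have h1 := (abs_le.1 (abs_sub_le_one_of_mem_neighbors h i)).2
  have hi : m i - n i = 1 := by omega
  refine hne (funext fun j => ?_)
  by_cases hj : j = i
  · subst hj
    simp
    omega
  · have hs := (mem_neighbors n m).1 h
    rw [← Finset.add_sum_erase _ _ (Finset.mem_univ i), hi] at hs
    have h0 : ∑ k ∈ Finset.univ.erase i, |m k - n k| = 0 := by
      simpa using hs
    have := (Finset.sum_eq_zero_iff_of_nonneg fun k _ => abs_nonneg _).1 h0 j (by simp [hj])
    rw [abs_eq_zero] at this
    simp [hj]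
    omega

theorem add_single_mem_neighbors {d : ℕ} (n : Fin d → ℤ) (i : Fin d) :
    n + Pi.single i 1 ∈ neighbors n := by
  rw [mem_neighbors, ← Finset.add_sum_erase _ _ (Finset.mem_univ i)]
  rw [Finset.sum_eq_zero]
  · simp
  · intro j hj
    simp [Finset.ne_of_mem_erase hj]

/-- Extension by zero of a function on a finite set of sites. -/
def extZero {d : ℕ} {s : Finset (Fin d → ℤ)} (v : EuclideanSpace ℂ s) (m : Fin d → ℤ) : ℂ :=
  if h : m ∈ s then v ⟨m, h⟩ else 0

theorem extZero_of_mem {d : ℕ} {s : Finset (Fin d → ℤ)} (v : EuclideanSpace ℂ s) {m : Fin d → ℤ}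
    (h : m ∈ s) : extZero v m = v ⟨m, h⟩ := dif_pos h

/-- The functions on the cube `[0, R)^d` that solve `∑_{|m'-m|=1} v_{m'} + V_m v_m = 0` at the
interior sites of the cube; no boundary condition is imposed. -/
def solutionSpace {d : ℕ} (R : ℤ) (V : (Fin d → ℤ) → ℂ) :
    Submodule ℂ (EuclideanSpace ℂ (box d 0 R)) where
  carrier := {v | ∀ m ∈ box d (0 + 1) (R - 1),
    ∑ m' ∈ neighbors m, extZero v m' + V m * extZero v m = 0}
  zero_mem' := by
    intro m _
    simp [extZero]
  add_mem' := by
    intro v w hv hw m hm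
    have hadd : ∀ m, extZero (v + w) m = extZero v m + extZero w m := fun m => by
      unfold extZero
      split_ifs <;> simp
    have h1 := hv m hm
    have h2 := hw m hm
    simp only [hadd, Finset.sum_add_distrib]
    linear_combination h1 + h2
  smul_mem' := by
    intro c v hv m hm
    have hsmul : ∀ m, extZero (c • v) m = c * extZero v m := fun m => by
      unfold extZero
      split_ifs <;> simp
    have h1 := hv m hm
    simp only [hsmul, ← Finset.mul_sum]
    linear_combination c * h1

/-- The sites of `[0, R)^d` that are not of the form `n + e_i` with `n` an interior site. -/
noncomputable def dataSites {d : ℕ} (i : Fin d) (R : ℤ) : Finset (Fin d → ℤ) :=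
  box d 0 R \ (box d (0 + 1) (R - 1)).image (· + Pi.single i 1)

theorem card_dataSites {d : ℕ} (i : Fin d) {R : ℤ} :
    (dataSites i R).card = R.toNat ^ d - (R - 2).toNat ^ d := by
  have hinj : Function.Injective (fun m : Fin d → ℤ => m + Pi.single i 1) :=
    add_left_injective _
  rw [dataSites, Finset.card_sdiff_of_subset, Finset.card_image_of_injective _ hinj, card_box,
    card_box]
  · congr 3
    · ring_nf
    · ring_nf
  · intro m hm
    obtain ⟨n, hn, rfl⟩ := Finset.mem_image.1 hm
    exact mem_box_of_mem_neighbors hn (add_single_mem_neighbors n i)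

/-- A solution is determined by its values on the data sites: the equation at `n` expresses its
value at `n + e_i` through values at sites with a smaller `i`-th coordinate. -/
theorem finrank_solutionSpace_le {d : ℕ} (i : Fin d) (R : ℤ) (V : (Fin d → ℤ) → ℂ) :
    Module.finrank ℂ (solutionSpace R V) ≤ R.toNat ^ d - (R - 2).toNat ^ d := by
  have hsub : ∀ x : dataSites i R, (x : Fin d → ℤ) ∈ box d 0 R := fun x =>
    (Finset.mem_sdiff.1 x.2).1
  let Φ : solutionSpace R V →ₗ[ℂ] (dataSites i R → ℂ) :=
    { toFun := fun v x => (v : EuclideanSpace ℂ (box d 0 R)) ⟨x, hsub x⟩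
      map_add' := fun v w => by ext; simp
      map_smul' := fun c v => by ext; simp }
  have hΦ : Function.Injective Φ := by
    rw [injective_iff_map_eq_zero]
    intro v hv
    -- Strong induction on the coordinate in the direction `e_i`.
    have key : ∀ (k : ℕ) (m : Fin d → ℤ), m i ≤ k → extZero v.1 m = 0 := by
      intro k
      induction k using Nat.strong_induction_on with
      | _ k ih =>
        intro m hmk
        by_cases hm : m ∈ box d 0 R
        swap
        · exact dif_neg hm
        by_cases hdata : m ∈ dataSites i R
        · rw [extZero_of_mem _ hm]
          exact congrFun hv ⟨m, hdata⟩
        · have himg : m ∈ (box d (0 + 1) (R - 1)).image (· + Pi.single i 1) := by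
            by_contra h
            exact hdata (Finset.mem_sdiff.2 ⟨hm, h⟩)
          obtain ⟨n, hn, rfl⟩ := Finset.mem_image.1 himg
          have hni := (mem_box.1 hn i).1
          have hmk' : n i + 1 ≤ k := by simpa using hmk
          have hlow : ∀ m', m' i ≤ n i → extZero v.1 m' = 0 := fun m' h =>
            ih (n i).toNat (by omega) m' (by omega)
          have heq := v.2 n hn
          rw [hlow n le_rfl, mul_zero, add_zero,
            Finset.sum_eq_single_of_mem _ (add_single_mem_neighbors n i)] at heq
          · exact heq
          · intro m' hm' hne
            exact hlow m' (le_of_mem_neighbors_of_ne i hm' hne)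
    ext x
    have := key (x.1 i).toNat x.1 (Int.self_le_toNat _)
    rw [extZero_of_mem _ x.2] at this
    simpa using this
  calc Module.finrank ℂ (solutionSpace R V) ≤ Module.finrank ℂ (dataSites i R → ℂ) :=
        LinearMap.finrank_le_finrank_of_injective hΦ
    _ = _ := by rw [Module.finrank_fintype_fun_eq_card, Fintype.card_coe, card_dataSites]

theorem neighbors_add {d : ℕ} (n t : Fin d → ℤ) (u : (Fin d → ℤ) → ℂ) :
    ∑ m ∈ neighbors (n + t), u m = ∑ m ∈ neighbors n, u (m + t) := by
  rw [sum_neighbors_eq, sum_neighbors_eq (fun m => u (m + t))]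
  exact Finset.sum_congr rfl fun e _ => by congr 1; abel

/-- The potential `V` is periodic on the cube `[0, L)^d`, with period `τ_i` in the direction `i`:
its values at two sites of the cube that differ by periods agree. -/
def PeriodicOnBox {d : ℕ} {X : Type*} (τ : Fin d → ℕ) (L : ℤ) (V : (Fin d → ℤ) → X) : Prop :=
  ∀ m ∈ box d 0 L, ∀ j : Fin d → ℤ, (fun i => m i + τ i * j i) ∈ box d 0 L →
    V (fun i => m i + τ i * j i) = V m

/-- Delocalization of solutions for a periodic potential: all the translates of the solution by
periods lie in one space, whose dimension is of the order of the surface of the cube. -/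
theorem norm_sq_mul_prod_le {d : ℕ} (i₀ : Fin d) {τ : Fin d → ℕ} (hτ : ∀ i, 0 < τ i) {K : ℕ}
    (hdvd : ∀ i, τ i ∣ K) {V u : (Fin d → ℤ) → ℂ}
    (hV : PeriodicOnBox τ (5 * K) V)
    (hu : ∀ m ∈ box d (0 + 1) (5 * K - 1), ∑ m' ∈ neighbors m, u m' + V m * u m = 0)
    {p : Fin d → ℤ} (hp : p ∈ box d K (4 * K)) :
    ((∏ i, K / τ i : ℕ) : ℝ) * ‖u p‖ ^ 2 ≤
      (((4 * K) ^ d - (4 * K - 2) ^ d : ℕ) : ℝ) * ∑ m ∈ box d 0 (5 * K), ‖u m‖ ^ 2 := by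
  obtain ⟨κ, hκ0, hκsum, hκ⟩ := exists_diagonal_bound (solutionSpace (4 * K) V)
  set A := ∑ m ∈ box d 0 (5 * K), ‖u m‖ ^ 2 with hA
  let J : Finset (Fin d → ℤ) := Fintype.piFinset fun i => Finset.Ico 0 ((K / τ i : ℕ) : ℤ)
  have hJ : ∀ j ∈ J, ∀ i, 0 ≤ τ i * j i ∧ τ i * j i < K := by
    intro j hj i
    have h := Finset.mem_Ico.1 (Fintype.mem_piFinset.1 hj i)
    have hpos : (0 : ℤ) < τ i := by exact_mod_cast hτ i
    refine ⟨mul_nonneg hpos.le h.1, ?_⟩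
    calc (τ i : ℤ) * j i < τ i * ((K / τ i : ℕ) : ℤ) := mul_lt_mul_of_pos_left h.2 hpos
      _ = K := by exact_mod_cast Nat.mul_div_cancel' (hdvd i)
  have hshift : ∀ j ∈ J, ∀ m ∈ box d 0 (4 * K), (fun i => m i + τ i * j i) ∈ box d 0 (5 * K) := by
    intro j hj m hm
    rw [mem_box] at hm ⊢
    intro i
    have h1 := hJ j hj i
    have h2 := hm i
    constructor <;> linarith
  have hback : ∀ j ∈ J, (fun i => p i - τ i * j i) ∈ box d 0 (4 * K) := by
    intro j hj
    rw [mem_box] at hp ⊢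
    intro i
    have h1 := hJ j hj i
    have h2 := hp i
    constructor <;> linarith
  -- The translate by the period vector `(τ_i j_i)_i` takes the value `u p` at `p - (τ_i j_i)_i`.
  have hone : ∀ j ∈ J, ‖u p‖ ^ 2 ≤
      (if h : (fun i => p i - τ i * j i) ∈ box d 0 (4 * K) then κ ⟨_, h⟩ else 0) * A := by
    intro j hj
    rw [dif_pos (hback j hj)]
    let v : EuclideanSpace ℂ (box d 0 (4 * K)) :=
      WithLp.toLp 2 fun m => u (fun i => m.1 i + τ i * j i)
    have hext : ∀ m ∈ box d 0 (4 * K), extZero v m = u (m + fun i => τ i * j i) := fun m hm =>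
      extZero_of_mem v hm
    have hv : v ∈ solutionSpace (4 * K) V := by
      intro m hm
      have hm0 : m ∈ box d 0 (4 * K) := by
        rw [mem_box] at hm ⊢
        intro i
        have := hm i
        omega
      have hmj : (m + fun i => τ i * j i) ∈ box d (0 + 1) (5 * K - 1) := by
        rw [mem_box] at hm ⊢
        intro i
        have h1 := hJ j hj i
        have h2 := hm i
        simp only [Pi.add_apply]
        constructor <;> linarith
      rw [Finset.sum_congr rfl fun m' hm' => hext m' (mem_box_of_mem_neighbors hm hm'),
        hext m hm0, ← neighbors_add]
      have h3 : V (m + fun i => τ i * j i) = V m := hV m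
        (by
          rw [mem_box] at hm0 ⊢
          intro i
          have := hm0 i
          omega) j (hshift j hj m hm0)
      rw [← h3]
      exact hu _ hmj
    have hnorm : ‖v‖ ^ 2 ≤ A := by
      rw [EuclideanSpace.norm_sq_eq, hA]
      change ∑ m : box d 0 (4 * K), ‖u (m.1 + fun i => τ i * j i)‖ ^ 2 ≤ _
      have hinj : Function.Injective
          (fun m : box d 0 (4 * K) => (m.1 + fun i => τ i * j i : Fin d → ℤ)) :=
        fun a b h => Subtype.ext (add_right_cancel h)
      rw [← Finset.sum_image (f := fun m => ‖u m‖ ^ 2) (s := Finset.univ)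
        (g := fun m : box d 0 (4 * K) => (m.1 + fun i => τ i * j i : Fin d → ℤ)) hinj.injOn]
      refine Finset.sum_le_sum_of_subset_of_nonneg ?_ fun _ _ _ => by positivity
      intro m hm
      obtain ⟨m', -, rfl⟩ := Finset.mem_image.1 hm
      exact hshift j hj m'.1 m'.2
    have hval := hκ v hv ⟨_, hback j hj⟩
    have hvp : v ⟨_, hback j hj⟩ = u p := by
      change u _ = u p
      congr 1
      funext i
      simp
    rw [hvp] at hval
    exact hval.trans (mul_le_mul_of_nonneg_left hnorm (hκ0 _))
  have hA0 : 0 ≤ A := Finset.sum_nonneg fun _ _ => by positivity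
  have hcardJ : J.card = ∏ i, K / τ i := by
    rw [Fintype.card_piFinset]
    exact Finset.prod_congr rfl fun i _ => by rw [Int.card_Ico, sub_zero, Int.toNat_natCast]
  calc ((∏ i, K / τ i : ℕ) : ℝ) * ‖u p‖ ^ 2 = ∑ _j ∈ J, ‖u p‖ ^ 2 := by
        rw [Finset.sum_const, hcardJ, nsmul_eq_mul]
    _ ≤ ∑ j ∈ J, (if h : (fun i => p i - τ i * j i) ∈ box d 0 (4 * K) then κ ⟨_, h⟩ else 0) * A :=
        Finset.sum_le_sum hone
    _ = (∑ j ∈ J.attach, κ ⟨_, hback j.1 j.2⟩) * A := by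
        rw [← Finset.sum_mul, ← Finset.sum_attach]
        congr 1
        exact Finset.sum_congr rfl fun j _ => dif_pos (hback j.1 j.2)
    _ ≤ (∑ m, κ m) * A := by
        -- Distinct period vectors use distinct sites of the cube.
        gcongr
        have hinj : Function.Injective
            (fun j : J => (⟨_, hback j.1 j.2⟩ : box d 0 (4 * K))) := by
          intro a b h
          refine Subtype.ext (funext fun i => ?_)
          have h1 := congrFun (congrArg Subtype.val h) i
          simpa [(hτ i).ne'] using h1
        rw [← Finset.sum_image (f := κ) (s := J.attach)
          (g := fun j : J => (⟨_, hback j.1 j.2⟩ : box d 0 (4 * K))) hinj.injOn]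
        exact Finset.sum_le_sum_of_subset_of_nonneg (Finset.subset_univ _) fun m _ _ => hκ0 m
    _ ≤ _ := by
        rw [hκsum]
        gcongr
        refine (finrank_solutionSpace_le i₀ (4 * K) V).trans (le_of_eq ?_)
        have h1 : (4 * (K : ℤ)).toNat = 4 * K := by omega
        have h2 : (4 * (K : ℤ) - 2).toNat = 4 * K - 2 := by omega
        rw [h1, h2]

/-! ### Stability under small perturbations of the potential -/

/-- The bound for exact solutions passes to approximate ones, uniformly over bounded periodic
potentials and bounded energies, because all the data range over a compact set. -/
theorem exists_stability_radius {d : ℕ} (i₀ : Fin d) {τ : Fin d → ℕ} (hτ : ∀ i, 0 < τ i) {K : ℕ}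
    (hdvd : ∀ i, τ i ∣ K) {c : ℝ}
    (hc : (((4 * K) ^ d - (4 * K - 2) ^ d : ℕ) : ℝ) < (∏ i, K / τ i : ℕ) * c) (M : ℝ) :
    ∃ δ > 0, ∀ (E : ℂ) (V : (Fin d → ℤ) → ℝ) (u : (Fin d → ℤ) → ℂ), ‖E‖ ≤ M → (∀ n, |V n| ≤ M) →
      (∀ n, ‖u n‖ ≤ 1) → ∑ m ∈ box d 0 (5 * K), ‖u m‖ ^ 2 ≤ 1 → PeriodicOnBox τ (5 * K) V →
      (∀ m ∈ box d (0 + 1) (5 * K - 1),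
        ‖∑ m' ∈ neighbors m, u m' + (V m : ℂ) * u m - E * u m‖ ≤ δ) →
      ∀ p ∈ box d K (4 * K), ‖u p‖ ^ 2 < c := by
  let Y := ℂ × ((Fin d → ℤ) → ℝ) × ((Fin d → ℤ) → ℂ)
  let T : Set Y := {y | ∑ m ∈ box d 0 (5 * K), ‖y.2.2 m‖ ^ 2 ≤ 1} ∩
    {y | PeriodicOnBox τ (5 * K) y.2.1} ∩ ⋃ p ∈ box d K (4 * K), {y | c ≤ ‖y.2.2 p‖ ^ 2}
  -- Compactness is that of a product: `T` involves finitely many sites only.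
  let C : Set Y := Metric.closedBall 0 M ×ˢ
    (Set.univ.pi (fun _ => Set.Icc (-M) M) ×ˢ Set.univ.pi fun _ => Metric.closedBall 0 1)
  have hC : IsCompact C := (isCompact_closedBall _ _).prod
    ((isCompact_univ_pi fun _ => isCompact_Icc).prod
      (isCompact_univ_pi fun _ => isCompact_closedBall _ _))
  have hT : IsClosed T := by
    refine (IsClosed.inter ?_ ?_).inter ?_
    · exact isClosed_le (by fun_prop) continuous_const
    · simp only [PeriodicOnBox, Set.ofPred_forall]
      refine isClosed_iInter fun m => isClosed_iInter fun _ => isClosed_iInter fun j =>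
        isClosed_iInter fun _ => isClosed_eq (by fun_prop) (by fun_prop)
    · exact isClosed_biUnion_finset fun p _ => isClosed_le continuous_const (by fun_prop)
  let Φ : Y → ℝ := fun y => ∑ m ∈ box d (0 + 1) (5 * K - 1),
    ‖∑ m' ∈ neighbors m, y.2.2 m' + (y.2.1 m : ℂ) * y.2.2 m - y.1 * y.2.2 m‖
  have hΦ : Continuous Φ := by fun_prop
  have hpos : ∀ y ∈ C ∩ T, 0 < Φ y := by
    rintro ⟨E, V, u⟩ ⟨-, ⟨hu, hV⟩, hp⟩
    refine lt_of_le_of_ne (Finset.sum_nonneg fun _ _ => norm_nonneg _) fun h0 => ?_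
    have hsol := (Finset.sum_eq_zero_iff_of_nonneg fun _ _ => norm_nonneg _).1 h0.symm
    simp only [Set.mem_iUnion, Set.mem_ofPred_eq] at hp hu hV
    obtain ⟨p, hp, hcp⟩ := hp
    have hmain := norm_sq_mul_prod_le i₀ hτ hdvd (V := fun m => (V m : ℂ) - E) (u := u)
      (fun m hm j hmj => by simp only [hV m hm j hmj])
      (fun m hm => by
        have := norm_eq_zero.1 (hsol m hm)
        linear_combination this) hp
    have h1 : ((∏ i, K / τ i : ℕ) : ℝ) * c ≤ ((∏ i, K / τ i : ℕ) : ℝ) * ‖u p‖ ^ 2 :=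
      mul_le_mul_of_nonneg_left hcp (Nat.cast_nonneg _)
    have h2 := mul_le_mul_of_nonneg_left hu
      (Nat.cast_nonneg (α := ℝ) ((4 * K) ^ d - (4 * K - 2) ^ d))
    linarith
  obtain ⟨μ, hμ, hμΦ⟩ : ∃ μ > 0, ∀ y ∈ C ∩ T, μ ≤ Φ y := by
    rcases (C ∩ T).eq_empty_or_nonempty with h | h
    · exact ⟨1, one_pos, by simp [h]⟩
    · obtain ⟨y, hy, hmin⟩ := (hC.inter_right hT).exists_isMinOn h hΦ.continuousOn
      exact ⟨Φ y, hpos y hy, fun z hz => hmin hz⟩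
  set k := (box d (0 + 1) (5 * (K : ℤ) - 1)).card with hk
  refine ⟨μ / (k + 1), by positivity, fun E V u hE hV hu1 hu hper happ p hp => ?_⟩
  by_contra! hcp
  have hmem : ((E, V, u) : Y) ∈ C ∩ T := by
    refine ⟨⟨by simpa using hE, fun n _ => abs_le.1 (hV n), fun n _ => by simpa using hu1 n⟩,
      ⟨hu, hper⟩, ?_⟩
    simp only [Set.mem_iUnion, Set.mem_ofPred_eq]
    exact ⟨p, hp, hcp⟩
  have h1 : Φ (E, V, u) ≤ k * (μ / (k + 1)) := by
    rw [← nsmul_eq_mul]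
    exact Finset.sum_le_card_nsmul _ _ _ happ
  have h2 : (k : ℝ) * (μ / (k + 1)) < μ := by
    rw [mul_div_assoc', div_lt_iff₀ (by positivity)]
    linarith
  linarith [hμΦ _ hmem]

theorem card_neighbors {d : ℕ} (n : Fin d → ℤ) :
    (neighbors n).card = (neighbors (0 : Fin d → ℤ)).card := by
  have := sum_neighbors_eq (fun _ => (1 : ℂ)) n
  simpa using this

/-- The energy of a bounded nonzero formal eigenfunction is at most `#{|e| = 1} + ‖f‖`. -/
theorem norm_eigenvalue_le {d : ℕ} {α : Fin d → ℝ} {f : C(Torus d, ℝ)} {x : Torus d} {E : ℂ}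
    {u : (Fin d → ℤ) → ℂ} (hu : ∀ n, formalH α f x u n = E * u n) (hbdd : ∀ n, ‖u n‖ ≤ 1)
    (hne : ∃ n, u n ≠ 0) : ‖E‖ ≤ (neighbors (0 : Fin d → ℤ)).card + ‖f‖ := by
  obtain ⟨n₀, hn₀⟩ := hne
  set S := ⨆ n, ‖u n‖ with hS
  have hB : BddAbove (Set.range fun n => ‖u n‖) := ⟨1, by rintro _ ⟨n, rfl⟩; exact hbdd n⟩
  have hle : ∀ n, ‖u n‖ ≤ S := fun n => le_ciSup hB n
  have hSpos : 0 < S := (norm_pos_iff.2 hn₀).trans_le (hle n₀)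
  have hsite : ∀ n, ‖E‖ * ‖u n‖ ≤ ((neighbors (0 : Fin d → ℤ)).card + ‖f‖) * S := by
    intro n
    rw [← norm_mul, ← hu n, formalH, add_mul]
    refine (norm_add_le _ _).trans (add_le_add ?_ ?_)
    · rw [← card_neighbors n, ← nsmul_eq_mul]
      exact (norm_sum_le _ _).trans (Finset.sum_le_card_nsmul _ _ _ fun m _ => hle m)
    · rw [norm_mul, Complex.norm_real]
      exact mul_le_mul (f.norm_coe_le_norm _) (hle n) (norm_nonneg _) (norm_nonneg _)
  have : ‖E‖ * S ≤ ((neighbors (0 : Fin d → ℤ)).card + ‖f‖) * S := by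
    rw [hS, Real.mul_iSup_of_nonneg (norm_nonneg _)]
    exact ciSup_le hsite
  exact le_of_mul_le_mul_right this hSpos

open MeasureTheory

/-! ### Towers for the shift on the torus -/

/-- The homomorphism `n ↦ (n_i α_i)_i` from `ℤ^d` to the torus. -/
noncomputable def orbitHom {d : ℕ} (α : Fin d → ℝ) : (Fin d → ℤ) →+ Torus d where
  toFun n i := (((n i : ℝ) * α i : ℝ) : UnitAddCircle)
  map_zero' := by
    funext i
    simp
  map_add' m n := by
    funext i
    simp [add_mul]

theorem shiftPhase_eq {d : ℕ} (α : Fin d → ℝ) (x : Torus d) (n : Fin d → ℤ) :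
    shiftPhase α x n = x + orbitHom α n := rfl

theorem volume_univ_torus (d : ℕ) : volume (Set.univ : Set (Torus d)) = 1 := by
  have : IsProbabilityMeasure (volume : Measure UnitAddCircle) := ⟨UnitAddCircle.measure_univ⟩
  exact measure_univ

theorem orbitHom_injective {d : ℕ} {α : Fin d → ℝ} (hα : ∀ i, Irrational (α i)) :
    Function.Injective (orbitHom α) := by
  rw [injective_iff_map_eq_zero]
  intro n hn
  funext i
  have h : (((n i : ℝ) * α i : ℝ) : UnitAddCircle) = 0 := congrFun hn i
  rw [AddCircle.coe_eq_zero_iff] at h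
  obtain ⟨k, hk⟩ := h
  by_contra hni
  have hni' : n i ≠ 0 := hni
  refine ((hα i).intCast_mul hni').ne_int k ?_
  simpa using hk.symm

/-- A maximal set `B` disjoint from its images under the nonzero shifts in `D`, built greedily along
a sequence of balls so small that each is disjoint from its own images. By maximality the images of
`B` under all the shifts in `D` cover the balls. -/
theorem exists_base {d : ℕ} {θ : (Fin d → ℤ) →+ Torus d} {D : Finset (Fin d → ℤ)}
    (hD0 : 0 ∈ D) (hDneg : ∀ n ∈ D, -n ∈ D) {r : ℝ}
    (hr : ∀ n ∈ D, ‖θ n‖ < 2 * r → n = 0) (e : ℕ → Torus d) (p : ℕ) :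
    ∃ B : Set (Torus d), MeasurableSet B ∧ (∀ x ∈ B, ∀ n ∈ D, x + θ n ∈ B → n = 0) ∧
      ∀ s < p, ∀ x ∈ Metric.ball (e s) r, ∃ n ∈ D, x + θ n ∈ B := by
  induction p with
  | zero => exact ⟨∅, MeasurableSet.empty, by simp, by simp⟩
  | succ p ih =>
    obtain ⟨B, hBm, hB, hcov⟩ := ih
    let N : Set (Torus d) := ⋃ n ∈ D, (fun x => x + θ n) ⁻¹' B
    have hN : MeasurableSet N := D.measurableSet_biUnion fun n _ =>
      (continuous_add_const (θ n)).measurable hBm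
    have hmemN : ∀ x, x ∈ N ↔ ∃ n ∈ D, x + θ n ∈ B := fun x => by simp [N]
    refine ⟨B ∪ (Metric.ball (e p) r \ N), hBm.union (Metric.isOpen_ball.measurableSet.diff hN),
      ?_, ?_⟩
    · rintro x (hx | hx) n hn (hxn | hxn)
      · exact hB x hx n hn hxn
      · exact absurd ((hmemN _).2 ⟨-n, hDneg n hn, by simpa using hx⟩) hxn.2
      · exact absurd ((hmemN _).2 ⟨n, hn, hxn⟩) hx.2
      · refine hr n hn ?_
        have h1 := dist_triangle_right (x + θ n) x (e p)
        rw [dist_eq_norm, add_sub_cancel_left] at h1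
        have h2 := Metric.mem_ball.1 hx.1
        have h3 := Metric.mem_ball.1 hxn.1
        linarith
    · intro s hs x hx
      rcases Nat.lt_succ_iff_lt_or_eq.1 hs with h | rfl
      · obtain ⟨n, hn, hxn⟩ := hcov s h x hx
        exact ⟨n, hn, Or.inl hxn⟩
      · by_cases hxN : x ∈ N
        · obtain ⟨n, hn, hxn⟩ := (hmemN x).1 hxN
          exact ⟨n, hn, Or.inl hxn⟩
        · exact ⟨0, hD0, Or.inr (by simpa using ⟨hx, hxN⟩)⟩

theorem exists_isCompact_half_measure_le {X : Type*} [TopologicalSpace X] [MeasurableSpace X]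
    {μ : Measure X} [IsFiniteMeasure μ] [μ.InnerRegular] {A : Set X}
    (hA : MeasurableSet A) : ∃ C ⊆ A, IsCompact C ∧ μ A ≤ 2 * μ C := by
  rcases eq_or_ne (μ A) 0 with h | h
  · exact ⟨∅, Set.empty_subset _, isCompact_empty, by simp [h]⟩
  · obtain ⟨C, hCA, hC, hlt⟩ := hA.exists_lt_isCompact
      (ENNReal.half_lt_self h (measure_ne_top μ A))
    refine ⟨C, hCA, hC, ?_⟩
    rw [ENNReal.div_lt_iff (by simp) (by simp), mul_comm] at hlt
    exact hlt.le

/-- Disjoint towers of height `[0, L)^d` over small compact sets, filling a proportion of the torus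
bounded below independently of `L`. -/
theorem exists_towers {d : ℕ} {θ : (Fin d → ℤ) →+ Torus d} (hθ : Function.Injective θ) {L : ℕ}
    (hL : 0 < L) {ρ : ℝ} (hρ : 0 < ρ) :
    ∃ (p : ℕ) (e : ℕ → Torus d) (C : Fin p → Set (Torus d)),
      (∀ s, IsCompact (C s)) ∧ (∀ s, ∀ x ∈ C s, dist x (e s) < ρ) ∧
      (∀ s s', ∀ x ∈ C s, ∀ x' ∈ C s', ∀ n ∈ box d 0 L, ∀ n' ∈ box d 0 L,
        x + θ n = x' + θ n' → s = s' ∧ n = n') ∧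
      1 ≤ 2 * (2 * L : ℝ≥0∞) ^ d * ∑ s, volume (C s) := by
  set D := box d (1 - L) L with hD
  have hD0 : (0 : Fin d → ℤ) ∈ D := mem_box.2 fun i => by
    simp only [Pi.zero_apply]
    omega
  have hDneg : ∀ n ∈ D, -n ∈ D := fun n hn => mem_box.2 fun i => by
    have := mem_box.1 hn i
    simp only [Pi.neg_apply]
    omega
  obtain ⟨r, hr0, hrρ, hr⟩ : ∃ r > 0, r ≤ ρ ∧ ∀ n ∈ D, ‖θ n‖ < 2 * r → n = 0 := by
    have hne : ∀ n ∈ D.erase 0, 0 < ‖θ n‖ := fun n hn => by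
      rw [norm_pos_iff, Ne, map_eq_zero_iff θ hθ]
      exact Finset.ne_of_mem_erase hn
    obtain ⟨σ, hσ, hσn⟩ : ∃ σ > 0, ∀ n ∈ D.erase 0, σ ≤ ‖θ n‖ := by
      rcases (D.erase 0).eq_empty_or_nonempty with h | h
      · exact ⟨1, one_pos, by simp [h]⟩
      · obtain ⟨n₀, hn₀, hmin⟩ := (D.erase 0).exists_min_image (fun n => ‖θ n‖) h
        exact ⟨_, hne n₀ hn₀, hmin⟩
    refine ⟨min ρ (σ / 2), by positivity, min_le_left _ _, fun n hn hlt => ?_⟩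
    by_contra h0
    have h1 := hσn n (Finset.mem_erase.2 ⟨h0, hn⟩)
    have h2 := min_le_right ρ (σ / 2)
    linarith
  obtain ⟨p, e, hcover⟩ : ∃ (p : ℕ) (e : ℕ → Torus d), ∀ x, ∃ s < p, x ∈ Metric.ball (e s) r := by
    let e := TopologicalSpace.denseSeq (Torus d)
    obtain ⟨t, ht⟩ := isCompact_univ.elim_finite_subcover (fun s => Metric.ball (e s) r)
      (fun s => Metric.isOpen_ball) fun x _ => by
        obtain ⟨s, hs⟩ := (TopologicalSpace.denseRange_denseSeq (Torus d)).exists_dist_lt x hr0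
        exact Set.mem_iUnion.2 ⟨s, hs⟩
    refine ⟨t.sup id + 1, e, fun x => ?_⟩
    obtain ⟨s, hs, hxs⟩ := Set.mem_iUnion₂.1 (ht (Set.mem_univ x))
    exact ⟨s, Nat.lt_succ_of_le (Finset.le_sup (f := id) hs), hxs⟩
  obtain ⟨B, hBm, hB, hBcov⟩ := exists_base hD0 hDneg hr e p
  -- `A s` collects the points of `B` whose first ball in the cover is the one around `e s`.
  let A : Fin p → Set (Torus d) := fun s =>
    B ∩ (Metric.ball (e s) r ∩ ⋂ s' : Fin p, ⋂ _ : s' < s, (Metric.ball (e s') r)ᶜ)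
  have hAm : ∀ s, MeasurableSet (A s) := fun s => hBm.inter (Metric.isOpen_ball.measurableSet.inter
    (MeasurableSet.iInter fun s' => MeasurableSet.iInter fun _ =>
      Metric.isOpen_ball.measurableSet.compl))
  have hBA : B ⊆ ⋃ s, A s := by
    intro x hx
    classical
    have hex := hcover x
    have hfind := Nat.find_spec hex
    refine Set.mem_iUnion.2 ⟨⟨Nat.find hex, hfind.1⟩, hx, hfind.2, ?_⟩
    simp only [Set.mem_iInter, Set.mem_compl_iff]
    intro s' hs' hmem
    exact Nat.find_min hex hs' ⟨s'.2, hmem⟩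
  choose C hCA hC hCvol using fun s => exists_isCompact_half_measure_le (μ := volume) (hAm s)
  refine ⟨p, e, C, hC, fun s x hx => (Metric.mem_ball.1 (hCA s hx).2.1).trans_le hrρ, ?_, ?_⟩
  · intro s s' x hx x' hx' n hn n' hn' heq
    have hxA := hCA s hx
    have hxA' := hCA s' hx'
    have hdiff : n - n' ∈ D := mem_box.2 fun i => by
      have h1 := mem_box.1 hn i
      have h2 := mem_box.1 hn' i
      simp only [Pi.sub_apply]
      omega
    have hxx : x + θ (n - n') = x' := by
      rw [map_sub, ← add_sub_assoc, heq, add_sub_cancel_right]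
    have hnn : n - n' = 0 := hB x hxA.1 _ hdiff (hxx ▸ hxA'.1)
    rw [hnn, map_zero, add_zero] at hxx
    subst hxx
    refine ⟨?_, sub_eq_zero.1 hnn⟩
    have h1 := hxA.2.2
    have h2 := hxA'.2.2
    simp only [Set.mem_iInter, Set.mem_compl_iff] at h1 h2
    by_contra hne
    rcases lt_or_gt_of_ne hne with h | h
    · exact h2 s h hxA.2.1
    · exact h1 s' h hxA'.2.1
  · have hcov : (1 : ℝ≥0∞) ≤ (2 * L : ℝ≥0∞) ^ d * volume B := by
      have huniv : (Set.univ : Set (Torus d)) ⊆ ⋃ n ∈ D, (fun x => x + θ n) ⁻¹' B := by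
        intro x _
        obtain ⟨s, hs, hxs⟩ := hcover x
        obtain ⟨n, hn, hxn⟩ := hBcov s hs x hxs
        exact Set.mem_iUnion₂.2 ⟨n, hn, hxn⟩
      calc (1 : ℝ≥0∞) = volume (Set.univ : Set (Torus d)) := (volume_univ_torus d).symm
        _ ≤ volume (⋃ n ∈ D, (fun x => x + θ n) ⁻¹' B) := measure_mono huniv
        _ ≤ ∑ n ∈ D, volume ((fun x => x + θ n) ⁻¹' B) := measure_biUnion_finset_le _ _
        _ = D.card * volume B := by
          simp only [measure_preimage_add_right, Finset.sum_const, nsmul_eq_mul]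
        _ ≤ _ := by
          gcongr
          rw [hD, card_box]
          push_cast
          gcongr
          have : ((L : ℤ) - (1 - L)).toNat ≤ 2 * L := by omega
          exact_mod_cast this
    calc (1 : ℝ≥0∞) ≤ (2 * L : ℝ≥0∞) ^ d * volume B := hcov
      _ ≤ (2 * L : ℝ≥0∞) ^ d * ∑ s, 2 * volume (C s) := by
        gcongr
        calc volume B ≤ volume (⋃ s, A s) := measure_mono hBA
          _ ≤ ∑ s, volume (A s) := measure_iUnion_fintype_le _ _
          _ ≤ _ := Finset.sum_le_sum fun s _ => hCvol s
      _ = _ := by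
        rw [← Finset.mul_sum]
        ring

open Filter Topology

/-! ### Approximation by functions with periodic pieces of orbits -/

/-- The orbit points of heights `n` and `n mod τ` are close when `τ_i α_i` is close to `ℤ`
compared with the inverse number of periods in the tower. -/
theorem norm_orbitHom_sub_emod_le {d : ℕ} {α : Fin d → ℝ} {τ : Fin d → ℕ} {L : ℕ}
    {σ : ℝ} (hσ : 0 ≤ σ)
    (hclose : ∀ i, (L / τ i : ℕ) * ‖(((τ i : ℝ) * α i : ℝ) : UnitAddCircle)‖ ≤ σ)
    {n : Fin d → ℤ} (hn : n ∈ box d 0 L) :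
    ‖orbitHom α n - orbitHom α (fun i => n i % τ i)‖ ≤ σ := by
  rw [← map_sub, pi_norm_le_iff_of_nonneg hσ]
  intro i
  have hni := mem_box.1 hn i
  obtain ⟨k, hk⟩ := Int.eq_ofNat_of_zero_le hni.1
  have hkL : k < L := by omega
  have h1 : n i - n i % τ i = (k / τ i : ℕ) * τ i := by
    rw [hk]
    push_cast
    have := Int.emod_add_mul_ediv (k : ℤ) (τ i)
    linarith
  have h2 : orbitHom α (n - fun i => n i % τ i) i =
      (k / τ i : ℕ) • (((τ i : ℝ) * α i : ℝ) : UnitAddCircle) := by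
    change ((((n i - n i % τ i : ℤ) : ℝ) * α i : ℝ) : UnitAddCircle) = _
    rw [h1, ← AddCircle.coe_nsmul, nsmul_eq_mul, Int.cast_mul, Int.cast_natCast, Int.cast_natCast,
      mul_assoc]
  rw [h2]
  refine (norm_nsmul_le (n := k / τ i)).trans (le_trans ?_ (hclose i))
  gcongr

/-- A continuous function can be modified slightly so as to be periodic in the height along the
towers over a set of phases of measure bounded below. -/
theorem exists_near_periodic {d : ℕ} {α : Fin d → ℝ} (hα : ∀ i, Irrational (α i))
    {τ : Fin d → ℕ} {K : ℕ} (hK : 0 < K) (f : C(Torus d, ℝ)) {η ω : ℝ} (hη : 0 ≤ η) (hω : 0 < ω)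
    (hfω : ∀ x y, dist x y < ω → dist (f x) (f y) ≤ η)
    (hclose : ∀ i, (5 * K / τ i : ℕ) * ‖(((τ i : ℝ) * α i : ℝ) : UnitAddCircle)‖ ≤ ω / 2) :
    ∃ (g : C(Torus d, ℝ)) (G : Set (Torus d)), dist g f ≤ η ∧ MeasurableSet G ∧
      1 ≤ 2 * 10 ^ d * volume G ∧
      ∀ x ∈ G, ∃ n ∈ box d (2 * K) (3 * K),
        PeriodicOnBox τ (5 * K) fun m => g (shiftPhase α x (m - n)) := by
  set θ := orbitHom α with hθ
  obtain ⟨p, e, C, hC, hCe, hdisj, hvol⟩ :=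
    exists_towers (orbitHom_injective hα) (L := 5 * K) (by positivity) (half_pos hω)
  let I := Fin p × box d 0 ((5 * K : ℕ) : ℤ)
  let Z : I → Set (Torus d) := fun q => (fun x => x + θ q.2) '' C q.1
  have hZc : ∀ q, IsClosed (Z q) := fun q =>
    ((hC q.1).image (continuous_add_const _)).isClosed
  have hZdisj : ∀ q q' y, y ∈ Z q → y ∈ Z q' → q = q' := by
    rintro ⟨s, n⟩ ⟨s', n'⟩ y ⟨x, hx, hxy⟩ ⟨x', hx', hxy'⟩
    obtain ⟨h1, h2⟩ := hdisj s s' x hx x' hx' n n.2 n' n'.2 (hxy.trans hxy'.symm)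
    exact Prod.ext h1 (Subtype.ext h2)
  -- The value imposed at height `n` above `C s`; it depends on `n` modulo the periods only.
  let w : I → ℝ := fun q => f (e q.1 + θ fun i => q.2.1 i % τ i)
  have hw : ∀ q, ∀ y ∈ Z q, |w q - f y| ≤ η := by
    rintro ⟨s, n⟩ y ⟨x, hx, rfl⟩
    rw [← Real.dist_eq, dist_comm]
    refine hfω _ _ ?_
    have h1 := norm_orbitHom_sub_emod_le (half_pos hω).le hclose n.2
    calc dist (x + θ n) (e s + θ fun i => n.1 i % τ i)
        ≤ dist x (e s) + dist (θ n) (θ fun i => n.1 i % τ i) := dist_add_add_le _ _ _ _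
      _ < ω / 2 + ω / 2 := add_lt_add_of_lt_of_le (hCe s x hx) (by rwa [dist_eq_norm])
      _ = ω := add_halves ω
  classical
  let h : Torus d → ℝ := fun y => if hy : ∃ q, y ∈ Z q then w hy.choose - f y else 0
  have hh : ∀ q, ∀ y ∈ Z q, h y = w q - f y := by
    intro q y hy
    have hex : ∃ q, y ∈ Z q := ⟨q, hy⟩
    change dite _ _ _ = _
    rw [dif_pos hex, hZdisj _ _ y hex.choose_spec hy]
  have hcont : ContinuousOn h (⋃ q, Z q) :=
    (locallyFinite_of_finite Z).continuousOn_iUnion hZc fun q =>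
      (continuousOn_const.sub f.continuous.continuousOn).congr (hh q)
  have hS : IsClosed (⋃ q, Z q) := isClosed_iUnion_of_finite hZc
  have : CompactSpace (⋃ q, Z q) := isCompact_iff_compactSpace.1 hS.isCompact
  obtain ⟨g₀, hg₀norm, hg₀⟩ := BoundedContinuousFunction.exists_norm_eq_domRestrict_eq_of_closed
    (BoundedContinuousFunction.mkOfCompact ⟨_, hcont.domRestrict⟩) hS
  have hg₀val : ∀ q, ∀ y ∈ Z q, g₀ y = w q - f y := by
    intro q y hy
    rw [← hh q y hy]
    exact DFunLike.congr_fun hg₀ (⟨y, Set.mem_iUnion.2 ⟨q, hy⟩⟩ : ⋃ q, Z q)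
  have hg₀le : ‖g₀‖ ≤ η := by
    rw [hg₀norm]
    refine (BoundedContinuousFunction.norm_le hη).2 ?_
    rintro ⟨y, hy⟩
    obtain ⟨q, hq⟩ := Set.mem_iUnion.1 hy
    change |h y| ≤ η
    rw [hh q y hq]
    exact hw q y hq
  let g : C(Torus d, ℝ) := f + g₀.toContinuousMap
  have hg : ∀ q, ∀ y ∈ Z q, g y = w q := by
    intro q y hy
    change f y + g₀ y = w q
    rw [hg₀val q y hy]
    ring
  have hmid : ∀ n ∈ box d (2 * K) (3 * K), n ∈ box d 0 ((5 * K : ℕ) : ℤ) := fun n hn =>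
    mem_box.2 fun i => by
      have := mem_box.1 hn i
      omega
  -- Phases in the middle of a tower see the whole tower within distance `2K` on both sides.
  let mid : I → Prop := fun q => q.2.1 ∈ box d (2 * K) (3 * K)
  refine ⟨g, ⋃ q : {q // mid q}, Z q.1, ?_, ?_, ?_, ?_⟩
  · rw [ContinuousMap.dist_le hη]
    intro y
    rw [Real.dist_eq, show g y - f y = g₀ y from add_sub_cancel_left _ _]
    exact (g₀.norm_coe_le_norm y).trans hg₀le
  · exact MeasurableSet.iUnion fun q => (hZc q.1).measurableSet
  · have hZvol : ∀ q, volume (Z q) = volume (C q.1) := fun q => by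
      change volume ((fun x => x + θ q.2) '' C q.1) = _
      rw [Set.image_add_right, measure_preimage_add_right]
    have hGvol : volume (⋃ q : {q // mid q}, Z q.1) = (K : ℝ≥0∞) ^ d * ∑ s, volume (C s) := by
      rw [measure_iUnion (fun q q' hne => Set.disjoint_left.2 fun y hy hy' =>
        hne (Subtype.ext (hZdisj _ _ y hy hy'))) fun q => (hZc q.1).measurableSet, tsum_fintype]
      simp only [hZvol]
      let E : {q // mid q} ≃ Fin p × box d (2 * K) (3 * K) :=
        { toFun := fun q => (q.1.1, ⟨q.1.2.1, q.2⟩)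
          invFun := fun q => ⟨(q.1, ⟨q.2.1, hmid _ q.2.2⟩), q.2.2⟩
          left_inv := fun q => rfl
          right_inv := fun q => rfl }
      refine (Fintype.sum_equiv E _ (fun q => volume (C q.1)) fun q => rfl).trans ?_
      rw [Fintype.sum_prod_type]
      simp only [Finset.sum_const, Finset.card_univ, Fintype.card_coe, card_box, nsmul_eq_mul,
        ← Finset.mul_sum]
      have : (3 * (K : ℤ) - 2 * K).toNat = K := by omega
      rw [this]
      push_cast
      rfl
    rw [hGvol]
    refine hvol.trans (le_of_eq ?_)
    push_cast
    rw [← mul_assoc, show (2 * 5 * K : ℝ≥0∞) = 10 * K by norm_num, mul_pow]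
    ring
  · intro x hx
    obtain ⟨⟨⟨s, n⟩, hn⟩, y, hy, rfl⟩ := Set.mem_iUnion.1 hx
    refine ⟨n, hn, ?_⟩
    have hval : ∀ m ∈ box d 0 (5 * K),
        g (shiftPhase α (y + θ n) (m - n)) = f (e s + θ fun i => m i % τ i) := by
      intro m hm
      have hm' : m ∈ box d 0 ((5 * K : ℕ) : ℤ) := by exact_mod_cast hm
      refine hg (s, ⟨m, hm'⟩) _ ⟨y, hy, ?_⟩
      rw [shiftPhase_eq, ← hθ, map_sub, add_assoc, add_sub_cancel]
    intro m hm j hmj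
    simp only
    rw [hval _ hmj, hval m hm]
    simp only [Int.add_mul_emod_self_left]

/-! ### Surface of a cube against its number of periods -/

/-- The surface of the cube of side `4K`, by Bernoulli's inequality. -/
theorem pow_sub_pow_mul_le (d K : ℕ) :
    (((4 * K) ^ d - (4 * K - 2) ^ d : ℕ) : ℝ) * (2 * K) ≤ d * (4 * K) ^ d := by
  rcases Nat.eq_zero_or_pos K with rfl | hK
  · rw [Nat.cast_zero, mul_zero, mul_zero, mul_zero]
    positivity
  have hK' : (1 : ℝ) ≤ K := by exact_mod_cast hK
  rw [Nat.cast_sub (Nat.pow_le_pow_left (Nat.sub_le _ _) d), Nat.cast_pow, Nat.cast_pow,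
    Nat.cast_sub (by omega)]
  push_cast
  set a : ℝ := 4 * K with ha
  have ha0 : 0 < a := by positivity
  have hb : 1 + (d : ℝ) * (-(2 / a)) ≤ (1 + -(2 / a)) ^ d := by
    refine one_add_mul_le_pow ?_ d
    rw [neg_le_neg_iff, div_le_iff₀ ha0]
    linarith
  have h1 : (a - 2) ^ d = a ^ d * (1 + -(2 / a)) ^ d := by
    rw [← mul_pow]
    congr 1
    field_simp
    ring
  have h2 : (a ^ d - (a - 2) ^ d) ≤ a ^ d * (d * (2 / a)) := by
    rw [h1]
    have := mul_le_mul_of_nonneg_left hb (pow_nonneg ha0.le d)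
    linarith
  calc (a ^ d - (a - 2) ^ d) * (2 * K) ≤ a ^ d * (d * (2 / a)) * (2 * K) := by gcongr
    _ = d * a ^ d := by
      rw [show (2 * K : ℝ) = a / 2 by rw [ha]; ring]
      field_simp

/-- With side length `K = N ∏ τ_j`, the surface of the cube is small compared with the number of
its cells of periods, once `N` is large. -/
theorem surface_lt {d : ℕ} {τ : Fin d → ℕ} (hτ : ∀ i, 0 < τ i) {N : ℕ} {c : ℝ}
    (hN : (d * 4 ^ d : ℝ) < N * c) {K : ℕ} (hK : K = N * ∏ j, τ j) (hK0 : 0 < K) :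
    (((4 * K) ^ d - (4 * K - 2) ^ d : ℕ) : ℝ) < (∏ i, K / τ i : ℕ) * c := by
  have hprod : ((∏ i, K / τ i : ℕ) : ℝ) * (∏ j, τ j : ℕ) = (K : ℝ) ^ d := by
    rw [← Nat.cast_mul, ← Finset.prod_mul_distrib, ← Nat.cast_pow]
    congr 1
    rw [Finset.prod_congr rfl fun i _ => Nat.div_mul_cancel
      (hK ▸ (Finset.dvd_prod_of_mem τ (Finset.mem_univ i)).mul_left N : τ i ∣ K)]
    simp
  have hQ : (0 : ℝ) < (∏ j, τ j : ℕ) := by exact_mod_cast Finset.prod_pos fun i _ => hτ i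
  have hKr : (0 : ℝ) < K := by exact_mod_cast hK0
  have hKN : (K : ℝ) = N * (∏ j, τ j : ℕ) := by exact_mod_cast hK
  have h1 := pow_sub_pow_mul_le d K
  have h2 : (d : ℝ) * (4 * K) ^ d * (∏ j, τ j : ℕ) < (∏ i, K / τ i : ℕ) * c * (2 * K) *
      (∏ j, τ j : ℕ) := by
    have h3 : (d * 4 ^ d : ℝ) * (K ^ d * (∏ j, τ j : ℕ)) < N * c * (K ^ d * (∏ j, τ j : ℕ)) := by
      gcongr
    have h4 : ((∏ i, K / τ i : ℕ) : ℝ) * c * (2 * K) * (∏ j, τ j : ℕ) =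
        2 * (N * c * (K ^ d * (∏ j, τ j : ℕ))) := by
      rw [← hprod, hKN]
      ring
    have h5 : 0 ≤ (d * 4 ^ d : ℝ) * (K ^ d * (∏ j, τ j : ℕ)) := by positivity
    rw [h4, mul_pow]
    linarith
  refine lt_of_mul_lt_mul_right (h1.trans_lt ?_) (by positivity : (0 : ℝ) ≤ 2 * K)
  exact lt_of_mul_lt_mul_right h2 hQ.le

/-! ### Potentials with delocalized eigenfunctions -/

/-- The potentials for which, on a set of phases of measure at least `1 / (2 · 10^d)`, all formal
eigenfunctions with `ℓ²` norm at most one satisfy `|u_p|² ≤ 1 / (k + 1)` for `|p|_∞ ≤ k`. What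
matters about the lower bound for the measure is that it does not depend on `k`. -/
def delocalized {d : ℕ} (α : Fin d → ℝ) (k : ℕ) : Set C(Torus d, ℝ) :=
  {f | ∃ G : Set (Torus d), MeasurableSet G ∧ 1 ≤ 2 * 10 ^ d * volume G ∧
    ∀ x ∈ G, ∀ (E : ℂ) (u : (Fin d → ℤ) → ℂ), (∀ s : Finset (Fin d → ℤ), ∑ m ∈ s, ‖u m‖ ^ 2 ≤ 1) →
      (∀ n, formalH α f x u n = E * u n) → ∀ p : Fin d → ℤ, (∀ i, |p i| ≤ k) →
        ‖u p‖ ^ 2 ≤ 1 / (k + 1)}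

/-- Near every potential there is a ball of delocalized potentials. -/
theorem exists_ball_subset_delocalized {d : ℕ} (i₀ : Fin d) {α : Fin d → ℝ}
    (hα : ∀ i, Irrational (α i)) {τ : ℕ → Fin d → ℕ} (hτpos : ∀ n i, 0 < τ n i)
    (hτ : ∀ i, Tendsto (fun n => ((∏ j, (τ n j : ℝ)) / (τ n i : ℝ)) *
        ‖(((τ n i : ℝ) * α i : ℝ) : UnitAddCircle)‖) atTop (𝓝 0))
    (k : ℕ) (f : C(Torus d, ℝ)) {η : ℝ} (hη : 0 < η) :
    ∃ g δ, 0 < δ ∧ dist g f ≤ η ∧ Metric.ball g δ ⊆ delocalized α k := by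
  obtain ⟨ω, hω, hfω⟩ := Metric.uniformContinuous_iff.1
    (CompactSpace.uniformContinuous_of_continuous f.continuous) η hη
  set c : ℝ := 1 / (k + 1) with hc
  -- The number of cells of periods per unit of surface; it has to exceed `d 4^d / c`.
  set N : ℕ := (d * 4 ^ d + 1) * (k + 1) with hN
  have hNc : (d * 4 ^ d : ℝ) < N * c := by
    rw [hN, hc]
    push_cast
    field_simp
    linarith
  have hev : ∀ᶠ n in atTop, ∀ i, 5 * N * (((∏ j, (τ n j : ℝ)) / (τ n i : ℝ)) *
      ‖(((τ n i : ℝ) * α i : ℝ) : UnitAddCircle)‖) < ω / 2 := by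
    rw [eventually_all]
    intro i
    have := (hτ i).const_mul (5 * N : ℝ)
    rw [mul_zero] at this
    exact this.eventually_lt_const (half_pos hω)
  obtain ⟨n, hn⟩ := hev.exists
  set K : ℕ := N * ∏ j, τ n j with hK
  have hQ : 0 < ∏ j, τ n j := Finset.prod_pos fun i _ => hτpos n i
  have hkK : k + 1 ≤ K := by
    rw [hK, hN]
    calc k + 1 = 1 * (k + 1) * 1 := by ring
      _ ≤ (d * 4 ^ d + 1) * (k + 1) * ∏ j, τ n j := by
        gcongr
        · omega
        · omega
  have hK0 : 0 < K := by omega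
  have hdvd : ∀ i, τ n i ∣ K := fun i =>
    (Finset.dvd_prod_of_mem (τ n) (Finset.mem_univ i)).mul_left N
  have hclose : ∀ i, (5 * K / τ n i : ℕ) * ‖(((τ n i : ℝ) * α i : ℝ) : UnitAddCircle)‖ ≤ ω / 2 := by
    intro i
    have hle : ((5 * K / τ n i : ℕ) : ℝ) ≤ 5 * N * ((∏ j, (τ n j : ℝ)) / τ n i) := by
      refine Nat.cast_div_le.trans (le_of_eq ?_)
      rw [hK]
      push_cast
      ring
    refine (mul_le_mul_of_nonneg_right hle (norm_nonneg _)).trans ?_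
    rw [mul_assoc]
    exact (hn i).le
  obtain ⟨g, G, hgf, hG, hGvol, hGper⟩ := exists_near_periodic hα hK0 f hη.le hω
    (fun x y hxy => (hfω hxy).le) hclose
  set M : ℝ := (neighbors (0 : Fin d → ℤ)).card + (‖g‖ + 1) with hM
  obtain ⟨δ, hδ, hstab⟩ := exists_stability_radius i₀ (hτpos n) hdvd
    (surface_lt (hτpos n) hNc hK hK0) M
  refine ⟨g, min δ 1, by positivity, hgf, fun f' hf' => ⟨G, hG, hGvol, ?_⟩⟩
  intro x hx E u hu hE p hp
  have hdist : dist f' g < min δ 1 := hf'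
  have hu1 : ∀ m, ‖u m‖ ≤ 1 := fun m => by
    have := hu {m}
    rw [Finset.sum_singleton] at this
    exact (sq_le_one_iff₀ (norm_nonneg _)).1 this
  by_cases hzero : ∃ m, u m ≠ 0
  swap
  · push Not at hzero
    rw [hzero p, norm_zero, zero_pow two_ne_zero]
    positivity
  have hEM : ‖E‖ ≤ M := by
    refine (norm_eigenvalue_le hE hu1 hzero).trans ?_
    rw [hM]
    gcongr
    have h1 : ‖f'‖ ≤ ‖g‖ + ‖f' - g‖ := norm_le_norm_add_norm_sub' f' g
    have h2 := hdist.trans_le (min_le_right δ 1)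
    rw [dist_eq_norm] at h2
    linarith
  have hgM : ∀ y, |g y| ≤ M := fun y => by
    have h1 : |g y| ≤ ‖g‖ := g.norm_coe_le_norm y
    have h2 : (0 : ℝ) ≤ (neighbors (0 : Fin d → ℤ)).card := Nat.cast_nonneg _
    linarith
  obtain ⟨t, ht, hper⟩ := hGper x hx
  have hpt : p + t ∈ box d K (4 * K) := mem_box.2 fun i => by
    have h1 := abs_le.1 (hp i)
    have h2 := mem_box.1 ht i
    have h3 : ((k : ℤ) + 1) ≤ K := by exact_mod_cast hkK
    simp only [Pi.add_apply]
    constructor <;> linarith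
  have hmain := hstab E (fun m => g (shiftPhase α x (m - t))) (fun m => u (m - t)) hEM
    (fun m => hgM _) (fun m => hu1 _)
    (by
      rw [← Finset.sum_image (f := fun m => ‖u m‖ ^ 2) (g := fun m => m - t)
        (sub_left_injective.injOn)]
      exact hu _)
    hper
    (fun m _ => by
      have h1 : ∑ m' ∈ neighbors m, u (m' - t) = ∑ m' ∈ neighbors (m - t), u m' := by
        rw [sub_eq_add_neg, neighbors_add]
        simp only [sub_eq_add_neg]
      have h2 := hE (m - t)
      rw [formalH] at h2
      have h3 : ∑ m' ∈ neighbors m, u (m' - t) +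
          ((g (shiftPhase α x (m - t)) : ℝ) : ℂ) * u (m - t) - E * u (m - t) =
          ((g (shiftPhase α x (m - t)) - f' (shiftPhase α x (m - t)) : ℝ) : ℂ) * u (m - t) := by
        rw [h1, ← h2]
        push_cast
        ring
      rw [h3, norm_mul, Complex.norm_real, ← mul_one δ]
      refine mul_le_mul ?_ (hu1 _) (norm_nonneg _) hδ.le
      rw [← dist_eq_norm, dist_comm]
      exact (ContinuousMap.dist_apply_le_dist _).trans (hdist.le.trans (min_le_left _ _)))
    (p + t) hpt
  rw [add_sub_cancel_right] at hmain
  exact hmain.le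

/-! ### Ergodicity and conclusion -/

theorem denseRange_orbitHom {d : ℕ} {α : Fin d → ℝ} (hα : ∀ i, Irrational (α i)) :
    DenseRange (orbitHom α) := by
  have h : DenseRange (Pi.map fun (i : Fin d) (k : ℤ) => k • ((α i : ℝ) : UnitAddCircle)) := by
    refine DenseRange.piMap fun i => ?_
    rw [AddCircle.denseRange_zsmul_coe_iff]
    simpa using hα i
  have heq : ⇑(orbitHom α) = Pi.map fun (i : Fin d) (k : ℤ) => k • ((α i : ℝ) : UnitAddCircle) := by
    funext n i
    change (((n i : ℝ) * α i : ℝ) : UnitAddCircle) = n i • ((α i : ℝ) : UnitAddCircle)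
    rw [← AddCircle.coe_zsmul, zsmul_eq_mul]
  rwa [heq]

/-- Almost every orbit of an irrational shift visits a given set of positive measure. -/
theorem ae_exists_add_orbitHom_mem {d : ℕ} {α : Fin d → ℝ} (hα : ∀ i, Irrational (α i))
    {X : Set (Torus d)} (hX : MeasurableSet X) (hpos : volume X ≠ 0) :
    ∀ᵐ x ∂(volume : Measure (Torus d)), ∃ n, x + orbitHom α n ∈ X := by
  let Y : Set (Torus d) := ⋃ n, (fun x => x + orbitHom α n) ⁻¹' X
  have hmemY : ∀ x, x ∈ Y ↔ ∃ n, x + orbitHom α n ∈ X := fun x => by simp [Y]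
  have hY : MeasurableSet Y := MeasurableSet.iUnion fun n =>
    (continuous_add_const (orbitHom α n)).measurable hX
  have hinv : ∀ n, (orbitHom α n +ᵥ ·) ⁻¹' Y = Y := by
    intro n
    ext x
    rw [Set.mem_preimage, hmemY, hmemY, vadd_eq_add]
    constructor
    · rintro ⟨m, hm⟩
      refine ⟨n + m, ?_⟩
      rwa [map_add, ← add_assoc, add_comm x]
    · rintro ⟨m, hm⟩
      refine ⟨m - n, ?_⟩
      rwa [map_sub, show orbitHom α n + x + (orbitHom α m - orbitHom α n) = x + orbitHom α m by abel]
  have : ErgodicVAdd (Torus d) (Torus d) volume := instErgodicVAddOfIsAddLeftInvariant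
  have hconst : EventuallyConst Y (ae (volume : Measure (Torus d))) :=
    aeconst_of_dense_setOfPred_preimage_vadd_eq (M := Torus d) hY.nullMeasurableSet
      ((denseRange_orbitHom hα).mono (by rintro _ ⟨n, rfl⟩; exact hinv n))
  have hXY : X ⊆ Y := fun x hx => (hmemY x).2 ⟨0, by simpa using hx⟩
  rcases eventuallyConst_set.1 hconst with h | h
  · exact h.mono fun x hx => (hmemY x).1 hx
  · refine absurd (measure_mono_null hXY ?_) hpos
    have : ∀ᵐ x ∂(volume : Measure (Torus d)), x ∉ Y := h
    simpa using measure_eq_zero_iff_ae_notMem.2 this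

/-- Delocalization at all scales excludes eigenvalues: at a phase that is good at infinitely many
scales every value `u_p` vanishes, and the eigenvalues do not change along an orbit of the shift. -/
theorem ae_not_hasEigenvalue {d : ℕ} {α : Fin d → ℝ} (hα : ∀ i, Irrational (α i))
    {f : C(Torus d, ℝ)} (hf : ∀ k, f ∈ delocalized α k) :
    ∀ᵐ x : Torus d ∂volume, ∀ E : ℂ, ¬ (H α f x).HasEigenvalue E := by
  choose G hG hGvol hGdel using hf
  have hfin : ∀ s : Set (Torus d), volume s ≠ ⊤ := fun s =>
    ((measure_mono (Set.subset_univ s)).trans_lt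
      ((volume_univ_torus d).trans_lt ENNReal.one_lt_top)).ne
  -- `X` is the set of phases that are good at infinitely many scales.
  let X : Set (Torus d) := ⋂ N : ℕ, ⋃ k ≥ N, G k
  have hUm : ∀ N : ℕ, MeasurableSet (⋃ k ≥ N, G k) := fun N =>
    MeasurableSet.iUnion fun k => MeasurableSet.iUnion fun _ => hG k
  have hXm : MeasurableSet X := MeasurableSet.iInter hUm
  have hXpos : volume X ≠ 0 := by
    have hanti : Antitone fun N : ℕ => ⋃ k ≥ N, G k := fun a b hab =>
      Set.biUnion_subset_biUnion_left fun k hk => le_trans hab hk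
    have hlim := tendsto_measure_iInter_atTop (μ := volume)
      (fun N => (hUm N).nullMeasurableSet) hanti ⟨0, hfin _⟩
    have hle : (2 * 10 ^ d : ℝ≥0∞)⁻¹ ≤ volume X := ge_of_tendsto' hlim fun N => by
      have h1 : volume (G N) ≤ volume (⋃ k ≥ N, G k) :=
        measure_mono (Set.subset_biUnion_of_mem (u := fun k => G k) (le_refl N))
      refine le_trans ?_ h1
      rw [ENNReal.inv_le_iff_le_mul (fun h => absurd h (hfin _))
        fun h => absurd h (ENNReal.mul_ne_top (by simp) (by simp))]
      exact hGvol N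
    intro h0
    rw [h0, nonpos_iff_eq_zero, ENNReal.inv_eq_zero] at hle
    exact ENNReal.mul_ne_top (by simp) (by simp) hle
  filter_upwards [ae_exists_add_orbitHom_mem hα hXm hXpos] with x hx E hE
  obtain ⟨n, hn⟩ := hx
  obtain ⟨u, hu⟩ := hE.exists_hasEigenvector
  have hu0 : ‖u‖ ≠ 0 := norm_ne_zero_iff.2 hu.2
  have heig : ∀ m, formalH α f x u m = E * u m := fun m =>
    congrArg (fun v : L2Z d => v m) hu.apply_eq_smul
  let w : (Fin d → ℤ) → ℂ := fun m => ((‖u‖⁻¹ : ℝ) : ℂ) * u (m + n)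
  have hw : ∀ m, formalH α f (x + orbitHom α n) w m = E * w m := by
    intro m
    have h1 := heig (m + n)
    have h2 : shiftPhase α x (m + n) = shiftPhase α (x + orbitHom α n) m := by
      rw [shiftPhase_eq, shiftPhase_eq, map_add, add_comm (orbitHom α m), add_assoc]
    rw [formalH, neighbors_add, h2] at h1
    rw [formalH, ← Finset.mul_sum]
    linear_combination ((‖u‖⁻¹ : ℝ) : ℂ) * h1
  have hwsum : ∀ s : Finset (Fin d → ℤ), ∑ m ∈ s, ‖w m‖ ^ 2 ≤ 1 := by
    intro s
    have h1 := lp.sum_rpow_le_norm_rpow (p := 2) (by norm_num) u (s.image (· + n))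
    rw [Finset.sum_image (add_left_injective n).injOn] at h1
    simp only [ENNReal.toReal_ofNat, Real.rpow_ofNat] at h1
    simp only [w, norm_mul, Complex.norm_real, norm_inv, norm_norm, mul_pow, ← Finset.mul_sum]
    calc ‖u‖⁻¹ ^ 2 * ∑ m ∈ s, ‖u (m + n)‖ ^ 2 ≤ ‖u‖⁻¹ ^ 2 * ‖u‖ ^ 2 := by gcongr
      _ = 1 := by rw [← mul_pow, inv_mul_cancel₀ hu0, one_pow]
  have hw0 : ∀ p, w p = 0 := by
    intro p
    obtain ⟨N₀, hN₀⟩ : ∃ N₀ : ℕ, ∀ i, |p i| ≤ N₀ := by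
      refine ⟨∑ i, (p i).natAbs, fun i => ?_⟩
      rw [Int.abs_eq_natAbs]
      exact_mod_cast Finset.single_le_sum (f := fun i => (p i).natAbs) (fun _ _ => Nat.zero_le _)
        (Finset.mem_univ i)
    have hle : ∀ N : ℕ, ‖w p‖ ^ 2 ≤ 1 / ((N : ℝ) + 1) := by
      intro N
      obtain ⟨k, hk, hxk⟩ := Set.mem_iUnion₂.1 (Set.mem_iInter.1 hn (max N N₀))
      refine (hGdel k _ hxk E w hwsum hw p fun i => (hN₀ i).trans ?_).trans ?_
      · exact_mod_cast (le_max_right N N₀).trans hk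
      · have : (N : ℝ) ≤ k := by exact_mod_cast (le_max_left N N₀).trans hk
        gcongr
    have := ge_of_tendsto' tendsto_one_div_add_atTop_nhds_zero_nat hle
    exact norm_eq_zero.1 (pow_eq_zero_iff two_ne_zero |>.1 (le_antisymm this (by positivity)))
  refine hu.2 (lp.ext (funext fun m => ?_))
  have h1 := hw0 (m - n)
  simpa [w, hu0] using h1

end QPSchrodinger

open QPSchrodinger MeasureTheory Filter Topology in
/-- The norm on `UnitAddCircle = ℝ/ℤ` of the class of `t` is the distance from `t` to `ℤ`. -/
theorem theorem1p2 (d : ℕ) (hd : 1 ≤ d) (α : Fin d → ℝ) (hα : ∀ i, Irrational (α i))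
    (τ : ℕ → Fin d → ℕ) (hτpos : ∀ n i, 0 < τ n i)
    (hτ : ∀ i, Tendsto
      (fun n => ((∏ j, (τ n j : ℝ)) / (τ n i : ℝ)) *
        ‖(((τ n i : ℝ) * α i : ℝ) : UnitAddCircle)‖) atTop (𝓝 0)) :
    ∃ 𝓕 : Set C(Torus d, ℝ), IsGδ 𝓕 ∧ Dense 𝓕 ∧
      ∀ f ∈ 𝓕, ∀ᵐ x : Torus d ∂volume, ∀ μ : ℂ, ¬ (H α f x).HasEigenvalue μ := by
  have : BaireSpace C(Torus d, ℝ) := .of_completelyPseudoMetrizable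
  refine ⟨⋂ k, interior (delocalized α k), .iInter_of_isOpen fun k => isOpen_interior,
    dense_iInter_of_isOpen_nat (fun k => isOpen_interior) fun k => ?_,
    fun f hf => ae_not_hasEigenvalue hα fun k => interior_subset (Set.mem_iInter.1 hf k)⟩
  rw [Metric.dense_iff]
  intro f r hr
  obtain ⟨g, δ, hδ, hgf, hball⟩ :=
    exists_ball_subset_delocalized ⟨0, hd⟩ hα hτpos hτ k f (half_pos hr)
  exact ⟨g, Metric.mem_ball.2 (hgf.trans_lt (half_lt_self hr)),
    mem_interior.2 ⟨_, hball, Metric.isOpen_ball, Metric.mem_ball_self hδ⟩⟩
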